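/- Let $q$ be a prime power. A set $\mathcal S$ of subsets of $GF(q)^n$ is an $(n,M,t)$ stego-code over $GF(q)$ if it consists of exactly $M$ non-empty pairwise disjoint sets whose union is $GF(q)^n$, and for every $x\in GF(q)^n$ and every $I\in\mathcal S$ one has $\min_{y\in I}\mathrm{Dist}(x,y)\le t$, where $\mathrm{Dist}$ is the Hamming distance. It is called maximum length embeddable (MLE) if moreover $$M=\sum_{i=0}^{t}(q-1)^i\binom ni .$$ A binary MLE code of length $n$ is an $(n,M,t)$ MLE code over $GF(2)$ for some $M,t\ge 0$; two codes are different if they are different as sets of subsets of $GF(2)^n$. Let $n=2^r-1$ with $r\ge 2$, and put $$B(n)=\frac{2^{2^{\frac{n+1}{2}-\log_2(n+1)}}\cdot 3^{2^{\frac{n-3}{4}}}\cdot 2^{2^{\frac{n+5}{4}-\log_2(n+1)}}}{n+1}.$$ Then there are at least $B(n)$ different binary MLE codes of length $n$. Moreover, if $r\ge 3$, there are at least $B(n)$ different $(n,n+1,1)$ MLE codes over $GF(2)$. -/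

import Mathlib

/-- `S` is an `M`-partition of `X`: a set of exactly `M` non-empty, pairwise disjoint
subsets of `X` whose union is `X`. -/
structure IsMPartition {X : Type*} (M : ℕ) (S : Set (Set X)) : Prop where
  finite : S.Finite
  ncard_eq : S.ncard = M
  nonempty : ∀ I ∈ S, I.Nonempty
  disjoint : ∀ I ∈ S, ∀ J ∈ S, I ≠ J → Disjoint I J
  cover : ⋃₀ S = Set.univ

/-- The distance `min_{y ∈ I} Dist(x, y)` from a vector to a (non-empty) set of vectors, for the
Hamming distance. -/
noncomputable def distToSet {F : Type*} [DecidableEq F] {n : ℕ}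
    (x : Fin n → F) (I : Set (Fin n → F)) : ℕ :=
  sInf ((fun y => hammingDist x y) '' I)

/-- `S` is an `(n, M, t)` stego-code over the finite field `F`. -/
structure IsStegoCode (F : Type*) [Field F] [Fintype F] [DecidableEq F]
    (n M t : ℕ) (S : Set (Set (Fin n → F))) : Prop where
  partition : IsMPartition M S
  dist_le : ∀ x : Fin n → F, ∀ I ∈ S, distToSet x I ≤ t

/-- `S` is a maximum length embeddable `(n, M, t)` stego-code over the finite field `F`: a
stego-code with `M = ∑_{i ≤ t} (q - 1)^i * C(n, i)`, where `q = |F|`. -/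
structure IsMLECode (F : Type*) [Field F] [Fintype F] [DecidableEq F]
    (n M t : ℕ) (S : Set (Set (Fin n → F))) : Prop where
  stego : IsStegoCode F n M t S
  card_eq : M = ∑ i ∈ Finset.range (t + 1), (Fintype.card F - 1) ^ i * n.choose i

/-- The number
`2^(2^((n+1)/2 - log₂(n+1))) * 3^(2^((n-3)/4)) * 2^(2^((n+5)/4 - log₂(n+1))) / (n+1)`,
with real division and real exponents. -/
noncomputable def mleLowerBound (n : ℕ) : ℝ :=
  (2 : ℝ) ^ ((2 : ℝ) ^ (((n : ℝ) + 1) / 2 - Real.logb 2 ((n : ℝ) + 1)))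
    * (3 : ℝ) ^ ((2 : ℝ) ^ (((n : ℝ) - 3) / 4))
    * (2 : ℝ) ^ ((2 : ℝ) ^ (((n : ℝ) + 5) / 4 - Real.logb 2 ((n : ℝ) + 1)))
    / ((n : ℝ) + 1)

/-! Write `n = 2m + 1` with `m = 2^d - 1`, `d = r - 1`. For any `f`, the Vasilev colouring
`vasilevTriple` uses `n + 1` colours and shows all of them in each ball of radius 1, so its classes
form an `(n, n+1, 1)` MLE code. Once `f` is normalised to vanish on a section of the syndrome, the
partition determines `f` (`eq_of_classes_vasilev_eq`). The remaining `2^m - 2^d` values are free,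
which gives `2^(2^m - 2^d)` codes; for `r ≥ 3` this already exceeds `B(n)`
(`mleLowerBound_le_two_pow`). For `n = 3` the count is only 1, and codes with other `t` are needed.
-/

/-- The non-zero vectors of `GF(2)^d`, indexing the coordinates of the Hamming code. -/
abbrev NonzeroVec (d : ℕ) : Type := {v : Fin d → ZMod 2 // v ≠ 0}

theorem card_nonzeroVec (d : ℕ) : Fintype.card (NonzeroVec d) = 2 ^ d - 1 := by
  rw [Fintype.card_subtype_compl]
  simp [ZMod.card]

/-- The syndrome map of the binary Hamming code of length `2 ^ d - 1`. -/
def syndrome {d : ℕ} (x : NonzeroVec d → ZMod 2) : Fin d → ZMod 2 :=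
  ∑ i, x i • i.1

theorem syndrome_add {d : ℕ} (x y : NonzeroVec d → ZMod 2) :
    syndrome (x + y) = syndrome x + syndrome y := by
  simp [syndrome, add_smul, Finset.sum_add_distrib]

theorem syndrome_single {d : ℕ} (i : NonzeroVec d) : syndrome (Pi.single i 1) = i.1 := by
  simp [syndrome, Pi.single_apply]

theorem syndrome_surjective (d : ℕ) : Function.Surjective (@syndrome d) := by
  intro s
  by_cases hs : s = 0
  · exact ⟨0, by simp [syndrome, hs]⟩
  · exact ⟨Pi.single ⟨s, hs⟩ 1, syndrome_single _⟩

/-- The colouring of `GF(2)^m × GF(2)^m × GF(2)` whose colour classes are the Vasilev codes built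
from the cosets of the Hamming code of length `m` and the function `f`. -/
def vasilevTriple {d : ℕ} (f : (NonzeroVec d → ZMod 2) → ZMod 2)
    (x y : NonzeroVec d → ZMod 2) (z : ZMod 2) : (Fin d → ZMod 2) × ZMod 2 :=
  (syndrome (x + y), ∑ i, x i + z + f (x + y))

/-- The colouring `vasilevTriple` transported to words of length `n` along a numbering of the
coordinates. -/
def vasilevColoring {d n : ℕ} (e : (NonzeroVec d ⊕ NonzeroVec d) ⊕ Unit ≃ Fin n)
    (f : (NonzeroVec d → ZMod 2) → ZMod 2) (w : Fin n → ZMod 2) : (Fin d → ZMod 2) × ZMod 2 :=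
  vasilevTriple f (fun i => w (e (.inl (.inl i)))) (fun i => w (e (.inl (.inr i))))
    (w (e (.inr ())))

/-! ### Vasilev colourings and balls of radius one -/

section Coloring

variable {d n : ℕ} (e : (NonzeroVec d ⊕ NonzeroVec d) ⊕ Unit ≃ Fin n)
  (f : (NonzeroVec d → ZMod 2) → ZMod 2)

theorem vasilevColoring_word (x y : NonzeroVec d → ZMod 2) (z : ZMod 2) :
    vasilevColoring e f (fun j => Sum.elim (Sum.elim x y) (fun _ => z) (e.symm j)) =
      vasilevTriple f x y z := by
  simp [vasilevColoring]

theorem hammingDist_add_single_le (w : Fin n → ZMod 2) (j : Fin n) :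
    hammingDist w (w + Pi.single j 1) ≤ 1 := by
  unfold hammingDist
  refine (Finset.card_le_card (t := {j}) ?_).trans (by simp)
  intro i hi
  by_contra h
  simp_all [Pi.single_apply]

theorem ZMod.two_eq_or_eq_add_one (a b : ZMod 2) : a = b ∨ a = b + 1 := by
  revert a b; decide

theorem vasilevColoring_flip_last (w : Fin n → ZMod 2) :
    vasilevColoring e f (w + Pi.single (e (.inr ())) 1) =
      vasilevColoring e f w + (0, 1) := by
  simp only [vasilevColoring, vasilevTriple, Pi.add_apply, Pi.single_apply, e.injective.eq_iff]
  simp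
  ring

theorem vasilevColoring_flip_right (w : Fin n → ZMod 2) (i : NonzeroVec d) :
    (vasilevColoring e f (w + Pi.single (e (.inl (.inr i))) 1)).1 =
      (vasilevColoring e f w).1 + i.1 := by
  have h' : ((fun k => (w + Pi.single (e (.inl (.inr i))) 1 : Fin n → ZMod 2)
      (e (.inl (.inr k)))) : NonzeroVec d → ZMod 2) =
      (fun k => w (e (.inl (.inr k)))) + Pi.single i 1 := by
    ext k; simp [Pi.single_apply, e.injective.eq_iff]
  simp only [vasilevColoring, vasilevTriple, h', syndrome_add, syndrome_single]
  simp [e.injective.eq_iff, add_assoc]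

/-- Both flips change `x + y` identically, so `f` and the syndrome cannot tell them apart; only the
parity of `x` does. -/
theorem vasilevColoring_flip_left (w : Fin n → ZMod 2) (i : NonzeroVec d) :
    vasilevColoring e f (w + Pi.single (e (.inl (.inl i))) 1) =
      vasilevColoring e f (w + Pi.single (e (.inl (.inr i))) 1) + (0, 1) := by
  have h : ((fun k => (w + Pi.single (e (.inl (.inl i))) 1 : Fin n → ZMod 2)
      (e (.inl (.inl k)))) : NonzeroVec d → ZMod 2) =
      (fun k => w (e (.inl (.inl k)))) + Pi.single i 1 := by
    ext k; simp [Pi.single_apply, e.injective.eq_iff]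
  have h' : ((fun k => (w + Pi.single (e (.inl (.inr i))) 1 : Fin n → ZMod 2)
      (e (.inl (.inr k)))) : NonzeroVec d → ZMod 2) =
      (fun k => w (e (.inl (.inr k)))) + Pi.single i 1 := by
    ext k; simp [Pi.single_apply, e.injective.eq_iff]
  have g : ((fun k => (w + Pi.single (e (.inl (.inl i))) 1 : Fin n → ZMod 2)
      (e (.inl (.inr k)))) : NonzeroVec d → ZMod 2) = fun k => w (e (.inl (.inr k))) := by
    ext k; simp [e.injective.eq_iff]
  have g' : ((fun k => (w + Pi.single (e (.inl (.inr i))) 1 : Fin n → ZMod 2)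
      (e (.inl (.inl k)))) : NonzeroVec d → ZMod 2) = fun k => w (e (.inl (.inl k))) := by
    ext k; simp [e.injective.eq_iff]
  simp only [vasilevColoring, vasilevTriple, h, h', g, g', add_right_comm _ (Pi.single i 1) _,
    add_assoc]
  simp [Finset.sum_add_distrib, Pi.single_apply, e.injective.eq_iff]
  ring

/-- Every ball of radius one contains every colour. -/
theorem exists_hammingDist_le_one_vasilevColoring_eq (w : Fin n → ZMod 2)
    (c : (Fin d → ZMod 2) × ZMod 2) :
    ∃ w', hammingDist w w' ≤ 1 ∧ vasilevColoring e f w' = c := by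
  by_cases hs : c.1 = (vasilevColoring e f w).1
  · rcases ZMod.two_eq_or_eq_add_one c.2 (vasilevColoring e f w).2 with h | h
    · exact ⟨w, by simp, (Prod.ext hs h).symm⟩
    · refine ⟨_, hammingDist_add_single_le w (e (.inr ())), ?_⟩
      rw [vasilevColoring_flip_last]
      exact (Prod.ext (by simpa using hs) h).symm
  -- The syndrome defect names the coordinate to flip; its left and right copies give the two
  -- parities.
  · let i : NonzeroVec d := ⟨c.1 - (vasilevColoring e f w).1, sub_ne_zero.2 hs⟩
    have hi := vasilevColoring_flip_right e f w i
    have hc : (vasilevColoring e f w).1 + i.1 = c.1 := add_sub_cancel _ _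
    rw [hc] at hi
    rcases ZMod.two_eq_or_eq_add_one c.2
      (vasilevColoring e f (w + Pi.single (e (.inl (.inr i))) 1)).2 with h | h
    · exact ⟨_, hammingDist_add_single_le w _, Prod.ext hi h.symm⟩
    · refine ⟨_, hammingDist_add_single_le w (e (.inl (.inl i))), ?_⟩
      rw [vasilevColoring_flip_left]
      exact Prod.ext (by simpa using hi) h.symm

end Coloring

/-! ### From colourings to codes -/

theorem distToSet_le {F : Type*} [DecidableEq F] {n t : ℕ} {x y : Fin n → F}
    {I : Set (Fin n → F)} (hy : y ∈ I) (h : hammingDist x y ≤ t) : distToSet x I ≤ t :=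
  (Nat.sInf_le (Set.mem_image_of_mem _ hy)).trans h

/-- The classes of a colouring that uses all its colours in every ball of radius `t` form a
stego-code. -/
theorem isStegoCode_classes_ker {F κ : Type*} [Field F] [Fintype F] [DecidableEq F] [Fintype κ]
    {n t : ℕ} (col : (Fin n → F) → κ)
    (h : ∀ w c, ∃ w', hammingDist w w' ≤ t ∧ col w' = c) :
    IsStegoCode F n (Fintype.card κ) t (Setoid.ker col).classes where
  partition :=
    { finite := Set.toFinite _
      ncard_eq := by
        have hsurj : Function.Surjective col := fun c => (h 0 c).imp fun _ hw => hw.2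
        rw [← Nat.card_coe_set_eq, ← Nat.card_eq_fintype_card]
        exact Nat.card_congr
          ((Setoid.quotientEquivClasses _).symm.trans (Setoid.quotientKerEquivOfSurjective col hsurj))
      nonempty := by
        rintro _ ⟨w, rfl⟩
        exact ⟨w, rfl⟩
      disjoint := fun I hI J hJ hne =>
        (Setoid.isPartition_classes _).pairwiseDisjoint hI hJ hne
      cover := (Setoid.isPartition_classes _).sUnion_eq_univ }
  dist_le := by
    rintro x _ ⟨w, rfl⟩
    obtain ⟨w', hd, hw'⟩ := h x (col w)
    exact distToSet_le hw' hd

theorem isMLECode_vasilev {d n : ℕ} (hn : n + 1 = 2 ^ (d + 1))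
    (e : (NonzeroVec d ⊕ NonzeroVec d) ⊕ Unit ≃ Fin n)
    (f : (NonzeroVec d → ZMod 2) → ZMod 2) :
    IsMLECode (ZMod 2) n (n + 1) 1 (Setoid.ker (vasilevColoring e f)).classes where
  stego := by
    have := isStegoCode_classes_ker _ (exists_hammingDist_le_one_vasilevColoring_eq e f)
    simpa [ZMod.card, ← pow_succ, ← hn] using this
  card_eq := by simp [Finset.sum_range_succ, ZMod.card, add_comm]

/-- A function vanishing on a section of the syndrome map is determined by its Vasilev
partition. -/
theorem eq_of_classes_vasilev_eq {d n : ℕ} (e : (NonzeroVec d ⊕ NonzeroVec d) ⊕ Unit ≃ Fin n)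
    {σ : (Fin d → ZMod 2) → NonzeroVec d → ZMod 2} (hσ : ∀ s, syndrome (σ s) = s)
    {f g : (NonzeroVec d → ZMod 2) → ZMod 2} (hf : ∀ s, f (σ s) = 0) (hg : ∀ s, g (σ s) = 0)
    (h : (Setoid.ker (vasilevColoring e f)).classes = (Setoid.ker (vasilevColoring e g)).classes) :
    f = g := by
  rw [← Setoid.classes_inj] at h
  funext x
  -- The words `(0, x, f x)` and `(0, σ s, 0)`, with `s` the syndrome of `x`, share a colour under
  -- `f`; sharing one under `g` forces `f x + g x = 0`.
  have key := Setoid.ext_iff.1 h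
    (fun j => Sum.elim (Sum.elim 0 x) (fun _ => f x) (e.symm j))
    (fun j => Sum.elim (Sum.elim 0 (σ (syndrome x))) (fun _ => 0) (e.symm j))
  simp only [Setoid.ker_def, vasilevColoring_word, vasilevTriple, zero_add, hσ, hf, hg,
    Prod.mk.injEq, true_and] at key
  simp only [Pi.zero_apply, Finset.sum_const_zero, zero_add, CharTwo.add_self_eq_zero,
    true_iff] at key
  exact CharTwo.add_eq_zero.1 key

theorem exists_coordinate_numbering {d n : ℕ} (hn : n + 1 = 2 ^ (d + 1)) :
    Nonempty ((NonzeroVec d ⊕ NonzeroVec d) ⊕ Unit ≃ Fin n) := by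
  rw [← Fintype.card_eq]
  have := Nat.one_le_two_pow (n := d)
  simp only [Fintype.card_sum, card_nonzeroVec, Fintype.card_unit, Fintype.card_fin]
  rw [pow_succ] at hn
  omega

theorem two_pow_le_ncard_isMLECode {d n : ℕ} (hn : n + 1 = 2 ^ (d + 1)) :
    2 ^ (2 ^ (2 ^ d - 1) - 2 ^ d) ≤
      {S : Set (Set (Fin n → ZMod 2)) | IsMLECode (ZMod 2) n (n + 1) 1 S}.ncard := by
  classical
  obtain ⟨e⟩ := exists_coordinate_numbering hn
  obtain ⟨σ, hσ⟩ := (syndrome_surjective d).hasRightInverse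
  let R : Set (NonzeroVec d → ZMod 2) := Set.range σ
  let extend (g : ↥Rᶜ → ZMod 2) (x : NonzeroVec d → ZMod 2) : ZMod 2 :=
    if hx : x ∈ Rᶜ then g ⟨x, hx⟩ else 0
  have hextend : ∀ g s, extend g (σ s) = 0 := fun g s => dif_neg (by simp [R])
  let code (g : ↥Rᶜ → ZMod 2) :
      {S : Set (Set (Fin n → ZMod 2)) | IsMLECode (ZMod 2) n (n + 1) 1 S} :=
    ⟨_, isMLECode_vasilev hn e (extend g)⟩
  have hinj : Function.Injective code := by
    intro g g' h
    have h' := eq_of_classes_vasilev_eq e hσ (hextend g) (hextend g') (congrArg Subtype.val h)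
    funext x
    simpa [extend, -Set.mem_compl_iff, x.2] using congrFun h' x.1
  have hR : Fintype.card ↥R = 2 ^ d := by
    rw [Set.card_range_of_injective hσ.injective]
    simp [ZMod.card]
  have hcard : Nat.card (↥Rᶜ → ZMod 2) = 2 ^ (2 ^ (2 ^ d - 1) - 2 ^ d) := by
    rw [Nat.card_eq_fintype_card, Fintype.card_fun, ZMod.card, Fintype.card_compl_set, hR,
      Fintype.card_fun, ZMod.card, card_nonzeroVec]
  rw [← hcard, ← Nat.card_coe_set_eq]
  exact Nat.card_le_card_of_injective code hinj

/-! ### Comparison with the bound -/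

/-- For the lengths `4k - 1 = 2 ^ r - 1` the bound has integral exponents. -/
theorem mleLowerBound_eq {r k n : ℕ} (hr : 2 ≤ r) (hk : k = 2 ^ (r - 2)) (hn : n + 1 = 2 ^ r) :
    mleLowerBound n =
      2 ^ 2 ^ (2 * k - r) * 3 ^ 2 ^ (k - 1) * 2 ^ 2 ^ (k + 1 - r) / 2 ^ r := by
  obtain ⟨s, rfl⟩ := Nat.exists_eq_add_of_le' hr
  have hks : s + 1 ≤ k := by
    rw [hk]; exact Nat.lt_two_pow_self
  have hnk : (n : ℝ) + 1 = 4 * k := by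
    have : n + 1 = 4 * k := by rw [hn, hk, pow_add, Nat.add_sub_cancel]; ring
    exact_mod_cast this
  have hn' : (n : ℝ) + 1 = 2 ^ (s + 2) := by exact_mod_cast hn
  have hlog : Real.logb 2 ((n : ℝ) + 1) = ((s + 2 : ℕ) : ℝ) := by
    rw [hn', ← Real.rpow_natCast, Real.logb_rpow (by norm_num) (by norm_num)]
  have e1 : ((n : ℝ) + 1) / 2 - Real.logb 2 ((n : ℝ) + 1) = ((2 * k - (s + 2) : ℕ) : ℝ) := by
    rw [hlog, hnk, Nat.cast_sub (by omega)]; push_cast; ring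
  have e2 : ((n : ℝ) - 3) / 4 = ((k - 1 : ℕ) : ℝ) := by
    rw [Nat.cast_sub (by omega)]; push_cast; linarith
  have e3 : ((n : ℝ) + 5) / 4 - Real.logb 2 ((n : ℝ) + 1) = ((k + 1 - (s + 2) : ℕ) : ℝ) := by
    rw [hlog]
    rw [show ((n : ℝ) + 5) / 4 = k + 1 by linarith, Nat.cast_sub (by omega)]; push_cast; ring
  have cast (a : ℝ) (m : ℕ) : a ^ ((2 : ℝ) ^ (m : ℝ)) = a ^ 2 ^ m := by
    rw [← Real.rpow_natCast a]
    congr 1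
    rw [Real.rpow_natCast]
    norm_cast
  rw [mleLowerBound, e1, e2, e3, cast, cast, cast, hn']

theorem exponent_bound {r k : ℕ} (hr : 3 ≤ r) (hk : k = 2 ^ (r - 2)) :
    2 ^ (2 * k - r) + 2 * 2 ^ (k - 1) + 2 ^ (k + 1 - r) ≤ 2 ^ (2 * k - 1) - 2 * k + r := by
  rcases hr.eq_or_lt with rfl | hr
  -- Equality holds here: both sides are 7.
  · norm_num at hk
    subst hk
    norm_num
  · have hk4 : 4 ≤ k := by
      rw [hk]
      exact Nat.pow_le_pow_right (n := 2) (by norm_num) (show 2 ≤ r - 2 by omega)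
    have h1 : 2 ^ (2 * k - r) ≤ 2 ^ (2 * k - 4) := Nat.pow_le_pow_right (by norm_num) (by omega)
    have h2 : 2 * 2 ^ (k - 1) ≤ 2 ^ (2 * k - 4) := by
      rw [← pow_succ']; exact Nat.pow_le_pow_right (by norm_num) (by omega)
    have h3 : 2 ^ (k + 1 - r) ≤ 2 ^ (2 * k - 4) := Nat.pow_le_pow_right (by norm_num) (by omega)
    have h4 : 2 ^ (2 * k - 1) = 8 * 2 ^ (2 * k - 4) := by
      rw [show 2 * k - 1 = 3 + (2 * k - 4) by omega, pow_add]; norm_num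
    have h5 : 2 * k - 4 < 2 ^ (2 * k - 4) := Nat.lt_two_pow_self
    omega

theorem mleLowerBound_le_two_pow {r n : ℕ} (hr : 3 ≤ r) (hn : n + 1 = 2 ^ r) :
    mleLowerBound n ≤ 2 ^ (2 ^ (2 ^ (r - 1) - 1) - 2 ^ (r - 1)) := by
  have h2 : 2 ^ (r - 1) = 2 * 2 ^ (r - 2) := by
    rw [← pow_succ']; congr 1; omega
  have hb := exponent_bound hr rfl
  rw [mleLowerBound_eq (by omega) rfl hn, div_le_iff₀ (by positivity), h2, ← pow_add]
  generalize 2 ^ (r - 2) = k at *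
  -- Bounding 3 by `2 ^ 2` leaves a comparison of exponents of 2.
  calc (2 : ℝ) ^ 2 ^ (2 * k - r) * 3 ^ 2 ^ (k - 1) * 2 ^ 2 ^ (k + 1 - r)
      ≤ 2 ^ 2 ^ (2 * k - r) * (2 ^ 2) ^ 2 ^ (k - 1) * 2 ^ 2 ^ (k + 1 - r) := by
        gcongr; norm_num
    _ = 2 ^ (2 ^ (2 * k - r) + 2 * 2 ^ (k - 1) + 2 ^ (k + 1 - r)) := by
        rw [← pow_mul, ← pow_add, ← pow_add]
    _ ≤ 2 ^ (2 ^ (2 * k - 1) - 2 * k + r) := pow_le_pow_right₀ (by norm_num) hb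

/-! ### The length three and the conclusion -/

/-- The partition with one class is an MLE code with `t = 0`. -/
theorem isMLECode_trivial (n : ℕ) :
    IsMLECode (ZMod 2) n 1 0 (Setoid.ker fun _ : Fin n → ZMod 2 => ()).classes where
  stego := by
    simpa using isStegoCode_classes_ker (F := ZMod 2) (t := 0) (fun _ : Fin n → ZMod 2 => ())
      fun w _ => ⟨w, by simp⟩
  card_eq := by simp

/-- The partition into singletons is an MLE code with `t = n`. -/
theorem isMLECode_singletons (n : ℕ) :
    IsMLECode (ZMod 2) n (2 ^ n) n (Setoid.ker (id : (Fin n → ZMod 2) → _)).classes where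
  stego := by
    simpa [ZMod.card] using isStegoCode_classes_ker (F := ZMod 2) (t := n)
      (id : (Fin n → ZMod 2) → _)
      fun w c => ⟨c, by simpa using hammingDist_le_card_fintype (x := w) (y := c), rfl⟩
  card_eq := by simp [ZMod.card, Nat.sum_range_choose]

/-- The codes for `t = 0, 1, 3` have 1, 4 and 8 classes, hence differ. -/
theorem three_le_ncard_isMLECode_length_three :
    3 ≤ {S : Set (Set (Fin 3 → ZMod 2)) | ∃ M t : ℕ, IsMLECode (ZMod 2) 3 M t S}.ncard := by
  obtain ⟨e⟩ := exists_coordinate_numbering (d := 1) (n := 3) (by norm_num)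
  have h₁ := isMLECode_trivial 3
  have h₂ := isMLECode_vasilev (by norm_num) e 0
  have h₃ := isMLECode_singletons 3
  have ne {M t M' t' : ℕ} {S T : Set (Set (Fin 3 → ZMod 2))} (hS : IsMLECode (ZMod 2) 3 M t S)
      (hT : IsMLECode (ZMod 2) 3 M' t' T) (hM : M ≠ M') : S ≠ T := by
    rintro rfl
    exact hM (hS.stego.partition.ncard_eq.symm.trans hT.stego.partition.ncard_eq)
  refine (Set.ncard_eq_three.2 ⟨_, _, _, ne h₁ h₂ (by norm_num), ne h₁ h₃ (by norm_num),
    ne h₂ h₃ (by norm_num), rfl⟩).symm.le.trans (Set.ncard_le_ncard ?_ (Set.toFinite _))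
  rintro S (rfl | rfl | rfl)
  exacts [⟨_, _, h₁⟩, ⟨_, _, h₂⟩, ⟨_, _, h₃⟩]

theorem corollary17 (r n : ℕ) (hr : 2 ≤ r) (hn : n = 2 ^ r - 1) :
    mleLowerBound n ≤
        ({S : Set (Set (Fin n → ZMod 2)) | ∃ M t : ℕ, IsMLECode (ZMod 2) n M t S}.ncard : ℝ) ∧
      (3 ≤ r → mleLowerBound n ≤
        ({S : Set (Set (Fin n → ZMod 2)) | IsMLECode (ZMod 2) n (n + 1) 1 S}.ncard : ℝ)) := by
  have hn' : n + 1 = 2 ^ r := by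
    have := Nat.one_le_two_pow (n := r)
    omega
  have main (hr3 : 3 ≤ r) : mleLowerBound n ≤
      ({S : Set (Set (Fin n → ZMod 2)) | IsMLECode (ZMod 2) n (n + 1) 1 S}.ncard : ℝ) := by
    refine (mleLowerBound_le_two_pow hr3 hn').trans ?_
    exact_mod_cast two_pow_le_ncard_isMLECode (d := r - 1)
      (by rw [hn']; congr 1; omega)
  refine ⟨?_, main⟩
  rcases hr.eq_or_lt with rfl | hr3
  · obtain rfl : n = 3 := by omega
    -- Here `B(3) = 2 * 3 * 2 / 4 = 3`.
    rw [mleLowerBound_eq (r := 2) (k := 1) le_rfl (by norm_num) (by norm_num)]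
    refine le_trans ?_ (Nat.cast_le.2 three_le_ncard_isMLECode_length_three)
    norm_num
  · refine (main hr3).trans (Nat.cast_le.2 ?_)
    exact Set.ncard_le_ncard (fun S hS => ⟨_, _, hS⟩) (Set.toFinite _)
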